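/- Let $n\ge 0$ and $r\ge 2$ be integers and let $0<p<1$. For a simple graph $\Gamma$ on the vertex set $\{1,\dots,n\}$, let $$G_\Gamma=\langle\, 1,\dots,n \;\mid\; vw=wv \text{ whenever } v,w \text{ are adjacent in } \Gamma\,\rangle$$ be its right-angled Artin group, and let $b_r(G_\Gamma)$ denote its $r$-th Betti number, that is, the rank of the group homology $H_r(G_\Gamma;\mathbb Z)$ with trivial coefficients. Let $\Gamma$ be a random graph $G(n,p)$: each of the $\binom n2$ possible edges is included independently with probability $p$, so that a given graph with $E$ edges has probability $p^{E}(1-p)^{\binom n2-E}$. Then $H_r(G_\Gamma;\mathbb Z)$ is finitely generated for every $\Gamma$ (so all these Betti numbers are finite), and $$\mathbf E\bigl(b_r(G_\Gamma)\bigr)=\binom nr\,p^{\binom r2}.$$ -/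

import Mathlib

/-- The relators of the right-angled Artin group of a graph: the commutators `v w v⁻¹ w⁻¹` of pairs of
adjacent vertices. -/
def raagRelators {V : Type*} (Γ : SimpleGraph V) : Set (FreeGroup V) :=
  {x | ∃ v w : V, Γ.Adj v w ∧
    x = FreeGroup.of v * FreeGroup.of w * (FreeGroup.of v)⁻¹ * (FreeGroup.of w)⁻¹}

/-- The right-angled Artin group `G_Γ = ⟨v ∈ V ∣ v w = w v whenever v, w are adjacent in Γ⟩`. -/
abbrev RAAG {V : Type*} (Γ : SimpleGraph V) : Type _ := PresentedGroup (raagRelators Γ)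

/-- The integral group homology `H_r(G; ℤ)`, with trivial coefficients. -/
noncomputable abbrev integralGroupHomology (G : Type) [Group G] (r : ℕ) : ModuleCat ℤ :=
  groupHomology (Rep.trivial ℤ G ℤ) r

/-- The `r`-th Betti number `b_r(G)` of a group: the rank of the abelian group `H_r(G; ℤ)`
(meaningful when this rank is finite). -/
noncomputable def groupBettiNumber (G : Type) [Group G] (r : ℕ) : ℕ :=
  Module.finrank ℤ (integralGroupHomology G r)

/-! For every graph, `H_n(G_Γ; ℤ)` is free abelian on the `n`-cliques
(`RAAG.nonempty_homologyEquiv`). Over `ℤ[G_Γ]`, take the Koszul complex of the elements `v - 1`,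
restricted to cliques, where these elements commute. Its coefficients lie in the augmentation ideal,
so all differentials vanish after tensoring with `ℤ`; since the complex resolves `ℤ`, `b_r` counts
the `r`-cliques. An `r`-set is a clique with probability `p ^ (r choose 2)`, and linearity of
expectation concludes.

Exactness (`Koszul.exists_diff_eq`) is proved algebraically. Adjoining a vertex `v` smaller than all
others forms the mapping cone of right multiplication by `v - 1`, from the complex of the link of
`v` to the complex of the remaining vertices. Induction works if `a * (v - 1)` in the left ideal of
`T` forces `a` into the left ideal of the neighbours of `v` in `T`. This colon condition
(`RAAG.mem_span_of_mul_aug_mem`) is detected by a Fox derivation, built from an action of the group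
by affine maps (`RAAG.exists_fox_derivation`). -/

open Finsupp in
/-- Two linear maps that agree on the basis vectors indexed by `s` agree on everything supported
in `s`. -/
lemma Finsupp.map_eq_of_mem_supported {ι R M : Type*} [Ring R] [AddCommGroup M] [Module R M]
    {s : Set ι} (f g : (ι →₀ R) →ₗ[R] M) (h : ∀ i ∈ s, f (single i 1) = g (single i 1))
    {x : ι →₀ R} (hx : x ∈ supported R R s) : f x = g x := by
  rw [supported_eq_span_single] at hx
  refine LinearMap.eqOn_span (f := f) (g := g) ?_ hx
  rintro _ ⟨i, hi, rfl⟩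
  exact h i hi

open Finsupp in
/-- A linear map sends everything supported in `s` into a submodule as soon as it does so for the
basis vectors indexed by `s`. -/
lemma Finsupp.map_mem_of_mem_supported {ι R M : Type*} [Ring R] [AddCommGroup M] [Module R M]
    {s : Set ι} (f : (ι →₀ R) →ₗ[R] M) (p : Submodule R M) (h : ∀ i ∈ s, f (single i 1) ∈ p)
    {x : ι →₀ R} (hx : x ∈ supported R R s) : f x ∈ p := by
  rw [supported_eq_span_single] at hx
  have : Submodule.span R ((fun i => single i (1 : R)) '' s) ≤ p.comap f := by
    rw [Submodule.span_le]
    rintro _ ⟨i, hi, rfl⟩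
    exact h i hi
  exact this hx

/-! ### Koszul complexes on the cliques of a graph -/

namespace Koszul

open Finsupp Finset

variable {V R : Type*} [LinearOrder V] [Ring R]

/-- The boundary of the basis element `σ`. -/
noncomputable def boundary (u : V → R) (σ : Finset V) : Finset V →₀ R :=
  ∑ v ∈ σ, single (σ.erase v) ((-1) ^ #{w ∈ σ | w < v} * u v)

/-- The Koszul differential attached to a family `u` of ring elements, on the free left module on
all finite sets of indices. -/
noncomputable def diff (u : V → R) : (Finset V →₀ R) →ₗ[R] (Finset V →₀ R) :=
  linearCombination R (boundary u)

/-- The map which inserts `v` into every basis element. -/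
noncomputable def insertMap (R : Type*) [Ring R] (v : V) :
    (Finset V →₀ R) →ₗ[R] (Finset V →₀ R) :=
  lmapDomain R R (insert v)

/-- Right multiplication by a ring element, as a left linear map. -/
noncomputable def rightMul (V : Type*) (r : R) : (Finset V →₀ R) →ₗ[R] (Finset V →₀ R) :=
  mapRange.linearMap (LinearMap.toSpanSingleton R R r)

variable (u : V → R)

lemma diff_single (σ : Finset V) (a : R) : diff u (single σ a) = a • boundary u σ := by
  simp [diff]

lemma insertMap_single (v : V) (σ : Finset V) (a : R) :
    insertMap R v (single σ a) = single (insert v σ) a := by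
  simp [insertMap]

omit [LinearOrder V] in
lemma rightMul_single (r : R) (σ : Finset V) (a : R) :
    rightMul V r (single σ a) = single σ (a * r) := by
  simp [rightMul]

omit [LinearOrder V] in
lemma rightMul_apply (r : R) (x : Finset V →₀ R) (σ : Finset V) :
    rightMul V r x σ = x σ * r := by
  simp [rightMul]

/-- The least vertex carries sign `+1`, and its presence shifts the position of every other vertex
by one, which flips the remaining signs. -/
lemma boundary_insert {v : V} {σ : Finset V} (h : ∀ w ∈ σ, v < w) :
    boundary u (insert v σ) = single σ (u v) - insertMap R v (boundary u σ) := by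
  have hv : v ∉ σ := fun hv => lt_irrefl _ (h v hv)
  have h0 : #{w ∈ insert v σ | w < v} = 0 := by
    rw [card_eq_zero, filter_eq_empty_iff]
    intro w hw
    rcases Finset.mem_insert.1 hw with rfl | hw
    · exact lt_irrefl _
    · exact (h w hw).asymm
  rw [boundary, sum_insert hv, h0, erase_insert hv, pow_zero, one_mul, sub_eq_add_neg, boundary,
    map_sum, ← sum_neg_distrib]
  congr 1
  refine Finset.sum_congr rfl fun w hw => ?_
  have hvw : v < w := h w hw
  rw [insertMap_single, erase_insert_of_ne hvw.ne, filter_insert, if_pos hvw,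
    card_insert_of_notMem (by simp [hv]), pow_succ', neg_one_mul, neg_mul, single_neg]

/-- This is the mapping cone formula on which all the inductions over the least vertex rest. -/
lemma diff_insertMap {v : V} {x : Finset V →₀ R}
    (hx : x ∈ supported R R {σ : Finset V | ∀ w ∈ σ, v < w}) :
    diff u (insertMap R v x) = rightMul V (u v) x - insertMap R v (diff u x) := by
  refine map_eq_of_mem_supported (diff u ∘ₗ insertMap R v)
    (rightMul V (u v) - insertMap R v ∘ₗ diff u) (fun σ hσ => ?_) hx
  simp [insertMap_single, diff_single, rightMul_single, boundary_insert u hσ]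

lemma diff_rightMul {r : R} {x : Finset V →₀ R}
    (hx : x ∈ supported R R {σ : Finset V | ∀ w ∈ σ, Commute (u w) r}) :
    diff u (rightMul V r x) = rightMul V r (diff u x) := by
  refine map_eq_of_mem_supported (diff u ∘ₗ rightMul V r) (rightMul V r ∘ₗ diff u)
    (fun σ hσ => ?_) hx
  simp only [LinearMap.comp_apply, rightMul_single, diff_single, boundary, map_sum, Finset.smul_sum,
    smul_single, smul_eq_mul, one_mul]
  refine Finset.sum_congr rfl fun w hw => ?_
  rw [mul_assoc, (hσ w hw).eq, ← mul_assoc, ← mul_assoc,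
    ((Commute.neg_one_left r).pow_left _).eq]

variable (Γ : SimpleGraph V)

/-- The cliques with `n` vertices inside `T`. -/
def cliques (T : Finset V) (n : ℕ) : Set (Finset V) :=
  {σ | σ ⊆ T ∧ Γ.IsNClique n σ}

/-- The submodule of Koszul chains on the cliques with `n` vertices inside `T`. -/
noncomputable def chains (R : Type*) [Ring R] (T : Finset V) (n : ℕ) :
    Submodule R (Finset V →₀ R) :=
  supported R R (cliques Γ T n)

variable {Γ}

omit [LinearOrder V] in
lemma mem_cliques {T σ : Finset V} {n : ℕ} :
    σ ∈ cliques Γ T n ↔ σ ⊆ T ∧ Γ.IsNClique n σ := Iff.rfl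

omit [LinearOrder V] in
lemma chains_mono {S T : Finset V} (h : S ⊆ T) (n : ℕ) : chains Γ R S n ≤ chains Γ R T n :=
  supported_mono fun _ hσ => ⟨hσ.1.trans h, hσ.2⟩

lemma erase_mem_cliques {T σ : Finset V} {n : ℕ} (h : σ ∈ cliques Γ T (n + 1)) {v : V}
    (hv : v ∈ σ) : σ.erase v ∈ cliques Γ T n :=
  ⟨(erase_subset _ _).trans h.1, h.2.erase_of_mem hv⟩

lemma insert_mem_cliques {T σ : Finset V} {n : ℕ} {v : V}
    [DecidablePred (Γ.Adj v)] (h : σ ∈ cliques Γ {w ∈ T | Γ.Adj v w} n) :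
    insert v σ ∈ cliques Γ (insert v T) (n + 1) :=
  ⟨insert_subset_insert _ (h.1.trans (filter_subset _ _)),
    h.2.insert fun _ hw => (Finset.mem_filter.1 (h.1 hw)).2⟩

lemma diff_mem_chains {T : Finset V} {n : ℕ} {x : Finset V →₀ R}
    (hx : x ∈ chains Γ R T (n + 1)) : diff u x ∈ chains Γ R T n := by
  refine map_mem_of_mem_supported _ _ (fun σ hσ => ?_) hx
  rw [diff_single, one_smul, boundary]
  exact Submodule.sum_mem _ fun v hv => single_mem_supported R _ (erase_mem_cliques hσ hv)

lemma diff_eq_zero_of_mem_chains_zero {T : Finset V} {x : Finset V →₀ R}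
    (hx : x ∈ chains Γ R T 0) : diff u x = 0 := by
  refine map_eq_of_mem_supported (diff u) 0 (fun σ hσ => ?_) hx
  rw [diff_single, card_eq_zero.1 hσ.2.card_eq]
  simp [boundary]

lemma insertMap_mem_chains {T : Finset V} {n : ℕ} {v : V} [DecidablePred (Γ.Adj v)]
    {x : Finset V →₀ R} (hx : x ∈ chains Γ R {w ∈ T | Γ.Adj v w} n) :
    insertMap R v x ∈ chains Γ R (insert v T) (n + 1) := by
  refine map_mem_of_mem_supported _ _ (fun σ hσ => ?_) hx
  rw [insertMap_single]
  exact single_mem_supported R _ (insert_mem_cliques hσ)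

omit [LinearOrder V] in
lemma rightMul_mem_chains {T : Finset V} {n : ℕ} (r : R) {x : Finset V →₀ R}
    (hx : x ∈ chains Γ R T n) : rightMul V r x ∈ chains Γ R T n := by
  refine map_mem_of_mem_supported _ _ (fun σ hσ => ?_) hx
  rw [rightMul_single]
  exact single_mem_supported R _ hσ

/-- For `v` below `σ`, the cone formula applied twice leaves `(dσ) u_v - (dσ) u_v` plus `v` inserted
into `ddσ`; commutation of `u_v` with the `u_w`, `w ∈ σ`, gives the first term. -/
lemma diff_diff_single (hu : ∀ v w, Γ.Adj v w → Commute (u v) (u w)) (σ : Finset V)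
    (hσ : Γ.IsClique (σ : Set V)) : diff u (diff u (single σ 1)) = 0 := by
  induction σ using Finset.induction_on_min with
  | empty => simp [diff_single, boundary]
  | insert v σ hv ih =>
    have hlt : single σ (1 : R) ∈ supported R R {τ : Finset V | ∀ w ∈ τ, v < w} :=
      single_mem_supported R _ hv
    have hadj : ∀ w ∈ σ, Γ.Adj v w := fun w hw =>
      hσ (by simp) (by simp [hw]) (hv w hw).ne
    have hcomm : single σ (1 : R) ∈ supported R R {τ : Finset V | ∀ w ∈ τ, Commute (u w) (u v)} :=
      single_mem_supported R _ fun w hw => (hu v w (hadj w hw)).symm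
    have hd : diff u (single σ 1) ∈ supported R R {τ : Finset V | ∀ w ∈ τ, v < w} := by
      rw [diff_single, one_smul, boundary]
      exact Submodule.sum_mem _ fun w _ =>
        single_mem_supported R _ fun x hx => hv x (mem_of_mem_erase hx)
    rw [← insertMap_single, diff_insertMap u hlt, map_sub, diff_insertMap u hd,
      diff_rightMul u hcomm, ih (hσ.subset (by simp))]
    simp

lemma diff_diff {T : Finset V} {n : ℕ} (hu : ∀ v w, Γ.Adj v w → Commute (u v) (u w))
    {x : Finset V →₀ R} (hx : x ∈ chains Γ R T n) : diff u (diff u x) = 0 :=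
  map_eq_of_mem_supported (diff u ∘ₗ diff u) 0
    (fun σ hσ => diff_diff_single u hu σ hσ.2.isClique) hx

/-- The map which removes `v` from the basis elements containing it and kills the others. -/
noncomputable def removeMap (R : Type*) [Ring R] (v : V) :
    (Finset V →₀ R) →ₗ[R] (Finset V →₀ R) :=
  linearCombination R fun σ => if v ∈ σ then single (σ.erase v) 1 else 0

lemma removeMap_eq_zero {v : V} {x : Finset V →₀ R}
    (hx : x ∈ supported R R {σ : Finset V | v ∉ σ}) : removeMap R v x = 0 :=
  map_eq_of_mem_supported (removeMap R v) 0
    (fun σ hσ => by simp [removeMap, show v ∉ σ from hσ]) hx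

lemma removeMap_insertMap {v : V} {x : Finset V →₀ R}
    (hx : x ∈ supported R R {σ : Finset V | v ∉ σ}) :
    removeMap R v (insertMap R v x) = x :=
  map_eq_of_mem_supported (removeMap R v ∘ₗ insertMap R v) LinearMap.id
    (fun σ hσ => by simp [removeMap, insertMap_single, erase_insert (show v ∉ σ from hσ)]) hx

omit [LinearOrder V] in
lemma chains_le_supported_notMem {T : Finset V} {v : V} (hv : v ∉ T) (n : ℕ) :
    chains Γ R T n ≤ supported R R {σ : Finset V | v ∉ σ} :=
  supported_mono fun _ hσ h => hv (hσ.1 h)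

/-- A clique containing `v` is `v` together with a clique in its link. -/
lemma exists_eq_add_insertMap {T : Finset V} {n : ℕ} {v : V} [DecidablePred (Γ.Adj v)]
    {x : Finset V →₀ R} (hx : x ∈ chains Γ R (insert v T) (n + 1)) :
    ∃ y ∈ chains Γ R T (n + 1), ∃ z ∈ chains Γ R {w ∈ T | Γ.Adj v w} n,
      y + insertMap R v z = x := by
  have : x ∈ chains Γ R T (n + 1) ⊔ (chains Γ R {w ∈ T | Γ.Adj v w} n).map (insertMap R v) := by
    refine map_mem_of_mem_supported LinearMap.id _ (fun σ hσ => ?_) hx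
    rw [LinearMap.id_apply]
    by_cases hv : v ∈ σ
    · refine Submodule.mem_sup_right ⟨single (σ.erase v) 1, single_mem_supported R _
        ⟨fun w hw => ?_, hσ.2.erase_of_mem hv⟩, by rw [insertMap_single, insert_erase hv]⟩
      obtain ⟨hne, hw⟩ := Finset.mem_erase.1 hw
      exact Finset.mem_filter.2 ⟨(Finset.mem_insert.1 (hσ.1 hw)).resolve_left hne,
        hσ.2.isClique hv hw hne.symm⟩
    · exact Submodule.mem_sup_left (single_mem_supported R _
        ⟨(subset_insert_iff_of_notMem hv).1 hσ.1, hσ.2⟩)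
  obtain ⟨y, hy, _, ⟨z, hz, rfl⟩, h⟩ := Submodule.mem_sup.1 this
  exact ⟨y, hy, z, hz, h⟩

omit [LinearOrder V] in
lemma mem_chains_zero_iff {T : Finset V} {x : Finset V →₀ R} :
    x ∈ chains Γ R T 0 ↔ x = single ∅ (x ∅) := by
  have : cliques Γ T 0 = {∅} := by
    ext σ
    constructor
    · exact fun h => card_eq_zero.1 h.2.card_eq
    · rintro rfl
      exact ⟨empty_subset _, by simp⟩
  rw [chains, this, mem_supported, ← Finset.coe_singleton, Finset.coe_subset,
    support_subset_singleton]

lemma diff_single_singleton (v : V) (a : R) :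
    diff u (single {v} a) = single ∅ (a * u v) := by
  have : #{w ∈ ({v} : Finset V) | w < v} = 0 := by
    rw [card_eq_zero, filter_eq_empty_iff]
    simp
  rw [diff_single, boundary, Finset.sum_singleton, this, erase_singleton]
  simp

lemma exists_diff_eq_single {T : Finset V} {a : R} (ha : a ∈ Ideal.span (u '' T)) :
    ∃ y ∈ chains Γ R T 1, diff u y = single ∅ a := by
  have : Ideal.span (u '' T) ≤
      ((chains Γ R T 1).map (diff u)).comap (lsingle (R := R) (∅ : Finset V)) := by
    rw [Ideal.span, Submodule.span_le]
    rintro _ ⟨v, hv, rfl⟩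
    refine ⟨single {v} 1, single_mem_supported R _ ⟨by simpa using hv, by simp⟩, ?_⟩
    rw [diff_single_singleton, one_mul, lsingle_apply]
  exact this ha

lemma diff_apply_empty_mem_span {T : Finset V} {y : Finset V →₀ R} (hy : y ∈ chains Γ R T 1) :
    diff u y ∅ ∈ Ideal.span (u '' T) := by
  refine map_mem_of_mem_supported (lapply ∅ ∘ₗ diff u) (Ideal.span (u '' T)) (fun σ hσ => ?_) hy
  obtain ⟨v, rfl⟩ := card_eq_one.1 hσ.2.card_eq
  rw [LinearMap.comp_apply, diff_single_singleton, one_mul, lapply_apply, single_eq_same]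
  exact Ideal.subset_span ⟨v, by simpa using hσ.1, rfl⟩

/-- A Koszul cycle on the cliques inside `T` is a boundary, provided the left ideals generated by
the `u v` satisfy the colon condition `h`. -/
theorem exists_diff_eq (hu : ∀ v w, Γ.Adj v w → Commute (u v) (u w))
    (h : ∀ (v : V) (T : Finset V), v ∉ T → ∀ a : R, a * u v ∈ Ideal.span (u '' T) →
      a ∈ Ideal.span (u '' {w | w ∈ T ∧ Γ.Adj v w}))
    (T : Finset V) (n : ℕ) {x : Finset V →₀ R} (hx : x ∈ chains Γ R T n)
    (hdx : diff u x = 0) (hx0 : n = 0 → x ∅ ∈ Ideal.span (u '' T)) :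
    ∃ y ∈ chains Γ R T (n + 1), diff u y = x := by
  classical
  cases n with
  -- The differential vanishes in degree `0`, so ideal membership replaces the cycle condition
  -- there.
  | zero =>
    rw [mem_chains_zero_iff.1 hx]
    exact exists_diff_eq_single u (hx0 rfl)
  | succ n =>
  clear hx0
  -- The induction hypothesis is needed both for `T` and for the link of `v` in `T`, hence the
  -- quantification over all subsets of `S`.
  suffices key : ∀ S : Finset V, ∀ T ⊆ S, ∀ (n : ℕ) (x : Finset V →₀ R),
      x ∈ chains Γ R T (n + 1) → diff u x = 0 → ∃ y ∈ chains Γ R T (n + 2), diff u y = x from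
    key T T subset_rfl n x hx hdx
  clear hx hdx T n x
  intro S
  induction S using Finset.induction_on_min with
  | empty =>
    intro T hT n x hx _
    refine ⟨0, zero_mem _, ?_⟩
    have : x ∈ supported R R (∅ : Set (Finset V)) := by
      refine supported_mono (fun σ hσ => ?_) hx
      have : σ = ∅ := subset_empty.1 (hσ.1.trans hT)
      simpa [this] using hσ.2.card_eq
    rw [supported_empty, Submodule.mem_bot] at this
    rw [this, map_zero]
  | insert v S hvS ih =>
    intro T hT n x hx hdx
    by_cases hv : v ∈ T
    swap
    · exact ih T ((subset_insert_iff_of_notMem hv).1 hT) n x hx hdx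
    obtain ⟨T, hvT, rfl⟩ : ∃ T' : Finset V, v ∉ T' ∧ insert v T' = T :=
      ⟨T.erase v, notMem_erase _ _, insert_erase hv⟩
    have hTS : T ⊆ S := fun w hw =>
      (Finset.mem_insert.1 (hT (mem_insert_of_mem hw))).resolve_left fun e => hvT (e ▸ hw)
    set L : Finset V := {w ∈ T | Γ.Adj v w} with hL
    have hLT : L ⊆ T := filter_subset _ _
    have hlt : ∀ m, chains Γ R L m ≤ supported R R {σ : Finset V | ∀ w ∈ σ, v < w} := fun m =>
      supported_mono fun σ hσ w hw => hvS w (hTS (hLT (hσ.1 hw)))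
    have hcomm : ∀ m, chains Γ R L m ≤
        supported R R {σ : Finset V | ∀ w ∈ σ, Commute (u w) (u v)} := fun m =>
      supported_mono fun σ hσ w hw => (hu v w (Finset.mem_filter.1 (hσ.1 hw)).2).symm
    obtain ⟨y, hy, z, hz, rfl⟩ := exists_eq_add_insertMap hx
    rw [map_add, diff_insertMap u (hlt n hz)] at hdx
    have hdz' : diff u z ∈ supported R R {σ : Finset V | v ∉ σ} := by
      cases n with
      | zero => rw [diff_eq_zero_of_mem_chains_zero u hz]; exact zero_mem _
      | succ n =>
        exact chains_le_supported_notMem (fun h => hvT (hLT h)) _ (diff_mem_chains u hz)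
    -- Only the term with `v` inserted into `dz` contains `v`, so it vanishes separately, leaving
    -- `dy + z u_v = 0`.
    have hdz : diff u z = 0 := by
      have h1 := congrArg (removeMap R v) hdx
      rwa [map_add, map_sub, removeMap_insertMap hdz',
        removeMap_eq_zero (chains_le_supported_notMem hvT _ (diff_mem_chains u hy)),
        removeMap_eq_zero (chains_le_supported_notMem hvT _ (rightMul_mem_chains _
          (chains_mono hLT _ hz))), map_zero, zero_sub, zero_add, neg_eq_zero] at h1
    rw [hdz, map_zero, sub_zero] at hdx
    -- The cycle `z` bounds in the link. If `z` has degree `0`, then `z ∅ * u v` is minus a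
    -- coefficient of `dy`, and the colon condition applies.
    obtain ⟨t, ht, rfl⟩ : ∃ t ∈ chains Γ R L (n + 1), diff u t = z := by
      cases n with
      | zero =>
        rw [mem_chains_zero_iff.1 hz]
        refine exists_diff_eq_single u ?_
        have h2 : z ∅ * u v ∈ Ideal.span (u '' T) := by
          rw [← rightMul_apply, eq_neg_of_add_eq_zero_right hdx, Finsupp.neg_apply]
          exact neg_mem (diff_apply_empty_mem_span u hy)
        simpa [hL] using h v T hvT _ h2
      | succ n => exact ih L (hLT.trans hTS) n z hz hdz
    -- With `dt = z`, the chain `y + t u_v` is a cycle without `v`, hence equal to some `ds`;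
    -- subtracting from `s` the chain `t` with `v` inserted gives the required primitive.
    have h3 : y + rightMul V (u v) t ∈ chains Γ R T (n + 1) :=
      add_mem hy (rightMul_mem_chains _ (chains_mono hLT _ ht))
    obtain ⟨s, hs, hds⟩ := ih T hTS n _ h3 (by rw [map_add, diff_rightMul u (hcomm _ ht), hdx])
    refine ⟨s - insertMap R v t,
      sub_mem (chains_mono (subset_insert _ _) _ hs) (insertMap_mem_chains ht), ?_⟩
    rw [map_sub, hds, diff_insertMap u (hlt _ ht)]
    abel

end Koszul

/-! ### The group ring of a right-angled Artin group -/

namespace RAAG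

variable {V : Type*} {Γ : SimpleGraph V}

/-- The generator of the right-angled Artin group at a vertex. -/
def gen (Γ : SimpleGraph V) (v : V) : RAAG Γ := PresentedGroup.of v

lemma gen_commute {v w : V} (h : Γ.Adj v w) : Commute (gen Γ v) (gen Γ w) := by
  have h1 : PresentedGroup.mk (raagRelators Γ)
      (FreeGroup.of v * FreeGroup.of w * (FreeGroup.of v)⁻¹ * (FreeGroup.of w)⁻¹) = 1 :=
    PresentedGroup.one_of_mem ⟨v, w, h, rfl⟩
  simp only [map_mul, map_inv] at h1
  exact eq_of_mul_inv_eq_one (by rw [mul_inv_rev, ← mul_assoc]; exact h1)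

/-- The universal property of the right-angled Artin group. -/
def lift {H : Type*} [Group H] (f : V → H) (hf : ∀ v w, Γ.Adj v w → Commute (f v) (f w)) :
    RAAG Γ →* H :=
  PresentedGroup.toGroup (f := f) <| by
    rintro _ ⟨v, w, h, rfl⟩
    simp [(hf v w h).eq]

@[simp]
lemma lift_gen {H : Type*} [Group H] (f : V → H)
    (hf : ∀ v w, Γ.Adj v w → Commute (f v) (f w)) (v : V) : lift f hf (gen Γ v) = f v :=
  PresentedGroup.toGroup.of _

/-- The element `v - 1` of the integral group ring. -/
noncomputable def aug (Γ : SimpleGraph V) (v : V) : MonoidAlgebra ℤ (RAAG Γ) :=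
  MonoidAlgebra.of ℤ _ (gen Γ v) - 1

lemma aug_commute (v w : V) (h : Γ.Adj v w) : Commute (aug Γ v) (aug Γ w) :=
  ((gen_commute h).map (MonoidAlgebra.of ℤ _)).sub_left (Commute.one_left _) |>.sub_right
    (Commute.one_right _)

/-- The elements `g` with `g - 1` in a given left ideal form a subgroup, and this one contains the
generators. -/
lemma of_sub_one_mem_span (g : RAAG Γ) :
    MonoidAlgebra.of ℤ _ g - 1 ∈ Ideal.span (Set.range (aug Γ)) := by
  set J := Ideal.span (Set.range (aug Γ))
  let H : Subgroup (RAAG Γ) :=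
    { carrier := {g | MonoidAlgebra.of ℤ _ g - 1 ∈ J}
      one_mem' := by rw [Set.mem_ofPred_eq, map_one, sub_self]; exact zero_mem J
      mul_mem' := fun {a b} ha hb => by
        have : MonoidAlgebra.of ℤ _ (a * b) - 1 =
            MonoidAlgebra.of ℤ _ a * (MonoidAlgebra.of ℤ _ b - 1) +
              (MonoidAlgebra.of ℤ _ a - 1) := by
          rw [map_mul]; noncomm_ring
        rw [Set.mem_ofPred_eq, this]
        exact add_mem (J.mul_mem_left _ hb) ha
      inv_mem' := fun {a} ha => by
        have : MonoidAlgebra.of ℤ _ a⁻¹ - 1 =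
            -(MonoidAlgebra.of ℤ _ a⁻¹ * (MonoidAlgebra.of ℤ _ a - 1)) := by
          rw [mul_sub, ← map_mul, inv_mul_cancel, map_one]; noncomm_ring
        rw [Set.mem_ofPred_eq, this]
        exact neg_mem (J.mul_mem_left _ ha) }
  exact PresentedGroup.generated_by _ H (fun v => Ideal.subset_span ⟨v, rfl⟩) g

/-- The additive map on the group ring with prescribed values on group elements. -/
noncomputable def extend {G M : Type*} [AddCommGroup M] (f : G → M) :
    MonoidAlgebra ℤ G →ₗ[ℤ] M :=
  Finsupp.linearCombination ℤ f ∘ₗ (MonoidAlgebra.coeffLinearEquiv ℤ).toLinearMap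

@[simp]
lemma extend_of {G M : Type*} [Monoid G] [AddCommGroup M] (f : G → M) (g : G) :
    extend f (MonoidAlgebra.of ℤ G g) = f g := by
  simp [extend]

/-- Here `extend (fun _ => 1)` is the augmentation `ε`. The element `a - ε(a)` is additive in `a`,
so group elements suffice. -/
lemma mem_span_of_extend_eq_zero {a : MonoidAlgebra ℤ (RAAG Γ)}
    (ha : extend (fun _ => (1 : ℤ)) a = 0) : a ∈ Ideal.span (Set.range (aug Γ)) := by
  have : a - algebraMap ℤ _ (extend (fun _ => (1 : ℤ)) a) ∈ Ideal.span (Set.range (aug Γ)) := by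
    clear ha
    induction a using MonoidAlgebra.induction_on with
    | of g => rw [extend_of, map_one]; exact of_sub_one_mem_span g
    | add a b ha hb =>
      rw [map_add, map_add, add_sub_add_comm]
      exact add_mem ha hb
    | smul n a ha =>
      have := zsmul_mem ha n
      rwa [smul_sub, ← map_zsmul, ← map_zsmul] at this
  simpa [ha] using this

lemma extend_mul_aug (a : MonoidAlgebra ℤ (RAAG Γ)) (v : V) :
    extend (fun _ => (1 : ℤ)) (a * aug Γ v) = 0 := by
  induction a using MonoidAlgebra.induction_on with
  | of g => rw [aug, mul_sub, mul_one, ← map_mul, map_sub, extend_of, extend_of, sub_self]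
  | add a b ha hb => rw [add_mul, map_add, ha, hb, add_zero]
  | smul n a ha => rw [smul_mul_assoc, map_zsmul, ha, smul_zero]

/-! ### Fox derivations and the colon condition -/

section Fox

variable {M : Type*} [AddCommGroup M] [Module (MonoidAlgebra ℤ (RAAG Γ)) M]

/-- Translation by a group element and then by a vector, as a permutation of a module over the
group ring. -/
noncomputable def affine (g : RAAG Γ) (e : M) : Equiv.Perm M where
  toFun m := MonoidAlgebra.of ℤ _ g • m + e
  invFun m := MonoidAlgebra.of ℤ _ g⁻¹ • (m - e)
  left_inv m := by
    beta_reduce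
    rw [add_sub_cancel_right, ← mul_smul, ← map_mul, inv_mul_cancel, map_one, one_smul]
  right_inv m := by
    beta_reduce
    rw [← mul_smul, ← map_mul, mul_inv_cancel, map_one, one_smul, sub_add_cancel]

lemma affine_apply (g : RAAG Γ) (e m : M) :
    affine g e m = MonoidAlgebra.of ℤ _ g • m + e := rfl

lemma affine_commute {g h : RAAG Γ} {d e : M} (hgh : Commute g h)
    (hde : MonoidAlgebra.of ℤ _ g • e + d = MonoidAlgebra.of ℤ _ h • d + e) :
    Commute (affine g d) (affine h e) := by
  ext m
  simp only [Equiv.Perm.mul_apply, affine_apply, smul_add, ← mul_smul, ← map_mul, hgh.eq,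
    add_assoc, hde]

open Classical in
/-- If the vector `e` is fixed by the generators in `T` adjacent to `v`, where `v ∉ T`, there is
an additive map on the group ring which vanishes on the left ideal of `T` and sends `a * (v - 1)` to
`a • e`. It is a Fox derivation in the direction of `v`, along the retraction onto the subgroup
generated by `T` and `v`. -/
theorem exists_fox_derivation (v : V) (T : Set V) (hv : v ∉ T) (e : M)
    (he : ∀ w ∈ T, Γ.Adj v w → MonoidAlgebra.of ℤ _ (gen Γ w) • e = e) :
    ∃ D : MonoidAlgebra ℤ (RAAG Γ) →ₗ[ℤ] M,
      (∀ a, ∀ w ∈ T, D (a * aug Γ w) = 0) ∧ ∀ a, D (a * aug Γ v) = a • e := by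
  -- Vertices outside `T ∪ {v}` are sent to `1`, because such neighbours of `v` need not fix `e`.
  let q : V → RAAG Γ := fun w => if w ∈ insert v T then gen Γ w else 1
  have hq : ∀ w w', Γ.Adj w w' → Commute (q w) (q w') := by
    intro w w' h
    simp only [q]
    split_ifs
    · exact gen_commute h
    · exact Commute.one_right _
    · exact Commute.one_left _
    · exact Commute.one_left _
  let c : V → M := fun w => if w = v then e else 0
  have hfix : ∀ w, Γ.Adj v w → MonoidAlgebra.of ℤ _ (q w) • e = e := by
    intro w h
    by_cases hw : w ∈ insert v T
    · have hwT : w ∈ T := hw.resolve_left h.ne'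
      simpa only [q, if_pos hw] using he w hwT h
    · simp only [q, if_neg hw, map_one, one_smul]
  have hc : ∀ w w', Γ.Adj w w' → Commute (affine (q w) (c w)) (affine (q w') (c w')) := by
    intro w w' h
    refine affine_commute (hq w w' h) ?_
    by_cases h1 : w = v
    · subst h1
      simp [c, h.ne', hfix w' h, -MonoidAlgebra.of_apply]
    · by_cases h2 : w' = v
      · subst h2
        simp [c, h1, hfix w h.symm, -MonoidAlgebra.of_apply]
      · simp [c, h1, h2]
  let ρ : RAAG Γ →* RAAG Γ := lift q hq
  let Φ : RAAG Γ →* Equiv.Perm M := lift (fun w => affine (q w) (c w)) hc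
  have hΦ : ∀ g m, Φ g m = MonoidAlgebra.of ℤ _ (ρ g) • m + Φ g 0 := by
    -- Stated for differences, the claim that `Φ g` has linear part `ρ g` ignores translations and
    -- passes to products and inverses.
    let H : Subgroup (RAAG Γ) :=
      { carrier := {g | ∀ m m', Φ g m - Φ g m' = MonoidAlgebra.of ℤ _ (ρ g) • (m - m')}
        one_mem' := fun m m' => by
          rw [map_one, map_one, map_one, one_smul, Equiv.Perm.one_apply, Equiv.Perm.one_apply]
        mul_mem' := fun {a b} ha hb m m' => by
          rw [map_mul, Equiv.Perm.mul_apply, Equiv.Perm.mul_apply, ha, hb, ← mul_smul, ← map_mul,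
            ← map_mul]
        inv_mem' := fun {a} ha m m' => by
          have h1 : ∀ n, Φ a (Φ a⁻¹ n) = n := fun n => by
            rw [← Equiv.Perm.mul_apply, ← map_mul, mul_inv_cancel, map_one, Equiv.Perm.one_apply]
          have h2 := ha (Φ a⁻¹ m) (Φ a⁻¹ m')
          rw [h1, h1] at h2
          rw [h2, ← mul_smul, ← map_mul, ← map_mul, inv_mul_cancel, map_one, map_one, one_smul] }
    intro g m
    have := PresentedGroup.generated_by _ H (fun w m m' => by
      change Φ (gen Γ w) m - Φ (gen Γ w) m' = MonoidAlgebra.of ℤ _ (ρ (gen Γ w)) • (m - m')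
      simp only [Φ, ρ, lift_gen, affine_apply, smul_sub]
      abel) g m 0
    rw [sub_zero] at this
    rw [← this, sub_add_cancel]
  -- `Φ g 0` is a cocycle for the action through `ρ`; the factor `g * (ρ g)⁻¹` turns the increment
  -- `ρ g • c w` into `g • c w`.
  let f : RAAG Γ → M := fun g => MonoidAlgebra.of ℤ _ (g * (ρ g)⁻¹) • Φ g 0
  have hf : ∀ g, ∀ w ∈ insert v T, f (g * gen Γ w) = f g + MonoidAlgebra.of ℤ _ g • c w := by
    intro g w hw
    have h1 : ρ (gen Γ w) = gen Γ w := by simp only [ρ, lift_gen, q, if_pos hw]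
    have h2 : Φ (gen Γ w) 0 = c w := by simp [Φ, affine_apply]
    have h3 : g * gen Γ w * (ρ (g * gen Γ w))⁻¹ = g * (ρ g)⁻¹ := by
      rw [map_mul, h1]; group
    simp only [f]
    rw [h3, map_mul Φ, Equiv.Perm.mul_apply, h2, hΦ g (c w), smul_add, ← mul_smul, ← map_mul,
      inv_mul_cancel_right, add_comm]
  have key : ∀ a, ∀ w ∈ insert v T, extend f (a * aug Γ w) = a • c w := by
    intro a w hw
    induction a using MonoidAlgebra.induction_on with
    | of g =>
      rw [aug, mul_sub, mul_one, ← map_mul, map_sub, extend_of, extend_of, hf g w hw,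
        add_sub_cancel_left]
    | add a b ha hb => rw [add_mul, map_add, ha, hb, add_smul]
    | smul n a ha => rw [smul_mul_assoc, map_zsmul, ha, smul_assoc]
  refine ⟨extend f, fun a w hw => ?_, fun a => ?_⟩
  · rw [key a w (Set.mem_insert_of_mem _ hw)]
    have : w ≠ v := fun h => hv (h ▸ hw)
    simp [c, this]
  · rw [key a v (Set.mem_insert _ _)]
    simp [c]

end Fox

/-- The colon condition for the left ideals of the group ring generated by sets of generators. -/
theorem mem_span_of_mul_aug_mem (v : V) (T : Set V) (hv : v ∉ T)
    (a : MonoidAlgebra ℤ (RAAG Γ)) (ha : a * aug Γ v ∈ Ideal.span (aug Γ '' T)) :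
    a ∈ Ideal.span (aug Γ '' {w | w ∈ T ∧ Γ.Adj v w}) := by
  set J : Submodule (MonoidAlgebra ℤ (RAAG Γ)) (MonoidAlgebra ℤ (RAAG Γ)) :=
    Ideal.span (aug Γ '' {w | w ∈ T ∧ Γ.Adj v w}) with hJ
  -- The module is `ℤ[G]/J` and `e` is the class of `1`, fixed by `w` because `w - 1 ∈ J`.
  obtain ⟨D, hD, hDv⟩ := exists_fox_derivation v T hv (J.mkQ 1) fun w hw hvw => by
    rw [← sub_eq_zero, ← map_smul, ← map_sub, Submodule.mkQ_apply, Submodule.Quotient.mk_eq_zero,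
      smul_eq_mul, mul_one]
    exact Ideal.subset_span ⟨w, ⟨hw, hvw⟩, rfl⟩
  -- `D` is only additive, so the left multiplier `b` is carried through the span induction.
  have h0 : ∀ x ∈ Ideal.span (aug Γ '' T), ∀ b, D (b * x) = 0 := by
    intro x hx
    induction hx using Submodule.span_induction with
    | mem x hx =>
      obtain ⟨w, hw, rfl⟩ := hx
      exact fun b => hD b w hw
    | zero => simp
    | add x y _ _ hx hy => intro b; rw [mul_add, map_add, hx, hy, add_zero]
    | smul r x _ hx => intro b; rw [smul_eq_mul, ← mul_assoc, hx]
  have := h0 _ ha 1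
  rwa [one_mul, hDv, ← map_smul, Submodule.mkQ_apply, Submodule.Quotient.mk_eq_zero, smul_eq_mul,
    mul_one] at this

end RAAG

/-! ### The Salvetti resolution and group homology -/

section Homology

open CategoryTheory

/-- The morphism of free representations given by a linear map over the group ring. -/
noncomputable def Rep.freeMap {G α β : Type} [Group G]
    (f : (α →₀ MonoidAlgebra ℤ G) →ₗ[MonoidAlgebra ℤ G] (β →₀ MonoidAlgebra ℤ G)) :
    Rep.free ℤ G α ⟶ Rep.free ℤ G β :=
  Rep.ofHom ⟨f.restrictScalars ℤ, fun g => by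
    have h : ∀ (γ : Type) (x : γ →₀ MonoidAlgebra ℤ G),
        Representation.free ℤ G γ g x = MonoidAlgebra.of ℤ G g • x := by
      intro γ x
      induction x using Finsupp.induction_linear with
      | zero => simp
      | add x y hx hy => rw [map_add, smul_add, hx, hy]
      | single i a =>
        induction a using MonoidAlgebra.induction_linear with
        | zero => simp
        | add a b ha hb => rw [Finsupp.single_add, map_add, smul_add, ha, hb]
        | single h n => simp
    refine LinearMap.ext fun x => ?_
    rw [LinearMap.comp_apply, LinearMap.comp_apply, h, h]
    exact f.map_smul _ _⟩

open RAAG in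
lemma Rep.coinvariantsTensor_map_freeMap_eq_zero {G α β : Type} [Group G]
    (f : (α →₀ MonoidAlgebra ℤ G) →ₗ[MonoidAlgebra ℤ G] (β →₀ MonoidAlgebra ℤ G))
    (hf : ∀ x b, extend (fun _ => (1 : ℤ)) (f x b) = 0) :
    ((Rep.coinvariantsTensor ℤ G).obj (Rep.trivial ℤ G ℤ)).map (Rep.freeMap f) = 0 := by
  classical
  -- Under `ℤ ⊗_G ℤ[G]^β ≅ ℤ^β`, the tensor `a ⊗ y` becomes `a` times the augmentation of `y`.
  have key : ∀ (a : ℤ) (y : β →₀ MonoidAlgebra ℤ G),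
      (Rep.coinvariantsTensorFreeLEquiv (Rep.trivial ℤ G ℤ) β)
        (Rep.coinvariantsTensorMk (Rep.trivial ℤ G ℤ) (Rep.free ℤ G β) a y) =
      a • Finsupp.mapRange.linearMap (extend (fun _ => (1 : ℤ))) y := by
    intro a y
    induction y using Finsupp.induction_linear with
    | zero => simp
    | add x y hx hy => simp only [map_add, hx, hy, smul_add]
    | single i b =>
      induction b using MonoidAlgebra.induction_linear with
      | zero => simp
      | add b c hb hc => simp only [Finsupp.single_add, map_add, hb, hc, smul_add]
      | single h n =>
        refine (Rep.coinvariantsTensorFreeToFinsupp_mk_tmul_single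
          (Rep.trivial ℤ G ℤ) a i h n).trans ?_
        simp [extend, mul_comm]
  refine Rep.coinvariantsTensor_hom_ext ?_
  refine LinearMap.ext fun a => LinearMap.ext fun x => ?_
  change Rep.coinvariantsTensorMk (Rep.trivial ℤ G ℤ) (Rep.free ℤ G β) a (f x) = 0
  apply (Rep.coinvariantsTensorFreeLEquiv (Rep.trivial ℤ G ℤ) β).injective
  rw [key, map_zero]
  have : Finsupp.mapRange.linearMap (extend (fun _ => (1 : ℤ))) (f x) = 0 := by
    ext b
    simpa using hf x b
  rw [this, smul_zero]

lemma Rep.shortComplex_exact_of_forall {k G : Type} [CommRing k] [Group G]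
    (S : ShortComplex (Rep.{0} k G))
    (h : ∀ x, S.g.hom x = 0 → ∃ y, S.f.hom y = x) : S.Exact := by
  apply (forget₂ (Rep.{0} k G) (ModuleCat.{0} k)).reflects_exact_of_faithful
  exact (ShortComplex.moduleCat_exact_iff _).2 h

namespace RAAG

variable {V : Type} [LinearOrder V] [Fintype V] (Γ : SimpleGraph V)

/-- The type of cliques with `n` vertices. -/
abbrev CliqueIndex (n : ℕ) : Type := ↥(Koszul.cliques Γ Finset.univ n)

/-- The free module of the Salvetti resolution in degree `n`, as Koszul chains. -/
noncomputable def chainsEquiv (n : ℕ) :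
    Koszul.chains Γ (MonoidAlgebra ℤ (RAAG Γ)) Finset.univ n ≃ₗ[MonoidAlgebra ℤ (RAAG Γ)]
      (CliqueIndex Γ n →₀ MonoidAlgebra ℤ (RAAG Γ)) :=
  Finsupp.supportedEquivFinsupp _

/-- The differential of the Salvetti resolution as a linear map over the group ring. -/
noncomputable def salvettiD (n : ℕ) :
    (CliqueIndex Γ (n + 1) →₀ MonoidAlgebra ℤ (RAAG Γ)) →ₗ[MonoidAlgebra ℤ (RAAG Γ)]
      (CliqueIndex Γ n →₀ MonoidAlgebra ℤ (RAAG Γ)) :=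
  (chainsEquiv Γ n).toLinearMap ∘ₗ
    (Koszul.diff (aug Γ)).restrict (fun _ hx => Koszul.diff_mem_chains (aug Γ) hx) ∘ₗ
    (chainsEquiv Γ (n + 1)).symm.toLinearMap

lemma coe_chainsEquiv_symm_salvettiD (n : ℕ)
    (x : CliqueIndex Γ (n + 1) →₀ MonoidAlgebra ℤ (RAAG Γ)) :
    ((chainsEquiv Γ n).symm (salvettiD Γ n x) : Finset V →₀ MonoidAlgebra ℤ (RAAG Γ)) =
      Koszul.diff (aug Γ) ((chainsEquiv Γ (n + 1)).symm x) := by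
  simp [salvettiD]

omit [LinearOrder V] in
lemma chainsEquiv_apply {n : ℕ} (x : Koszul.chains Γ (MonoidAlgebra ℤ (RAAG Γ)) Finset.univ n)
    (σ : CliqueIndex Γ n) : chainsEquiv Γ n x σ = (x : Finset V →₀ _) σ := rfl

lemma salvettiD_comp (n : ℕ) (x : CliqueIndex Γ (n + 2) →₀ MonoidAlgebra ℤ (RAAG Γ)) :
    salvettiD Γ n (salvettiD Γ (n + 1) x) = 0 := by
  apply (chainsEquiv Γ n).symm.injective
  apply Subtype.ext
  rw [coe_chainsEquiv_symm_salvettiD, coe_chainsEquiv_symm_salvettiD, map_zero]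
  exact Koszul.diff_diff _ aug_commute ((chainsEquiv Γ (n + 2)).symm x).2

lemma exists_salvettiD_eq (n : ℕ) (x : CliqueIndex Γ n →₀ MonoidAlgebra ℤ (RAAG Γ))
    (hx : Koszul.diff (aug Γ) ((chainsEquiv Γ n).symm x) = 0)
    (hx0 : n = 0 → ((chainsEquiv Γ n).symm x : Finset V →₀ MonoidAlgebra ℤ (RAAG Γ)) ∅ ∈
      Ideal.span (aug Γ '' (Finset.univ : Finset V))) :
    ∃ y, salvettiD Γ n y = x := by
  obtain ⟨y, hy, hyx⟩ := Koszul.exists_diff_eq (aug Γ) aug_commute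
    (fun v T hv a ha => mem_span_of_mul_aug_mem v T hv a ha) Finset.univ n
    ((chainsEquiv Γ n).symm x).2 hx hx0
  refine ⟨chainsEquiv Γ (n + 1) ⟨y, hy⟩, ?_⟩
  apply (chainsEquiv Γ n).symm.injective
  apply Subtype.ext
  rw [coe_chainsEquiv_symm_salvettiD, LinearEquiv.symm_apply_apply, hyx]

lemma range_salvettiD_succ (n : ℕ) :
    LinearMap.range (salvettiD Γ (n + 1)) = LinearMap.ker (salvettiD Γ n) := by
  ext x
  constructor
  · rintro ⟨y, rfl⟩
    exact salvettiD_comp Γ n y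
  · intro hx
    refine exists_salvettiD_eq Γ (n + 1) x ?_ (by simp)
    rw [← coe_chainsEquiv_symm_salvettiD, LinearMap.mem_ker.1 hx, map_zero]
    rfl

/-- Every coefficient of the differential is a sum of left multiples of elements `v - 1`. -/
lemma extend_salvettiD (n : ℕ) (x : CliqueIndex Γ (n + 1) →₀ MonoidAlgebra ℤ (RAAG Γ))
    (σ : CliqueIndex Γ n) : extend (fun _ => (1 : ℤ)) (salvettiD Γ n x σ) = 0 := by
  have h : ∀ y : Finset V →₀ MonoidAlgebra ℤ (RAAG Γ), ∀ τ,
      extend (fun _ => (1 : ℤ)) (Koszul.diff (aug Γ) y τ) = 0 := by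
    intro y τ
    induction y using Finsupp.induction_linear with
    | zero => simp
    | add y z hy hz => rw [map_add, Finsupp.add_apply, map_add, hy, hz, add_zero]
    | single ρ a =>
      rw [Koszul.diff_single, Koszul.boundary, Finset.smul_sum, Finsupp.finsetSum_apply, map_sum]
      refine Finset.sum_eq_zero fun v _ => ?_
      rw [Finsupp.smul_single, smul_eq_mul, ← mul_assoc, Finsupp.single_apply]
      split_ifs
      · exact extend_mul_aug _ v
      · exact map_zero _
  have := h ((chainsEquiv Γ (n + 1)).symm x) σ
  rwa [← coe_chainsEquiv_symm_salvettiD, ← chainsEquiv_apply, LinearEquiv.apply_symm_apply] at this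

/-- The empty clique. -/
def emptyClique : CliqueIndex Γ 0 := ⟨∅, Finset.empty_subset _, by simp⟩

omit [LinearOrder V] in
lemma eq_emptyClique (σ : CliqueIndex Γ 0) : σ = emptyClique Γ :=
  Subtype.ext (Finset.card_eq_zero.1 σ.2.2.card_eq)

/-- The augmentation of the Salvetti resolution. -/
noncomputable def salvettiAug : Rep.free ℤ (RAAG Γ) (CliqueIndex Γ 0) ⟶ Rep.trivial ℤ (RAAG Γ) ℤ :=
  Rep.ofHom ⟨extend (fun _ => (1 : ℤ)) ∘ₗ Finsupp.lapply (emptyClique Γ), fun g => by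
    refine LinearMap.ext fun x => ?_
    induction x using Finsupp.induction_linear with
    | zero => simp
    | add x y hx hy => rw [map_add, map_add, hx, hy]
    | single i a =>
      obtain rfl := eq_emptyClique Γ i
      induction a using MonoidAlgebra.induction_linear with
      | zero => simp
      | add a b ha hb => rw [Finsupp.single_add, map_add, map_add, ha, hb]
      | single h n => simp [extend]⟩

omit [LinearOrder V] in
lemma salvettiAug_apply (x : CliqueIndex Γ 0 →₀ MonoidAlgebra ℤ (RAAG Γ)) :
    (salvettiAug Γ).hom x = extend (fun _ => (1 : ℤ)) (x (emptyClique Γ)) := rfl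

omit [LinearOrder V] in
lemma salvettiAug_surjective (n : ℤ) : ∃ y, (salvettiAug Γ).hom y = n := by
  refine ⟨Finsupp.single (emptyClique Γ) (MonoidAlgebra.single 1 n), ?_⟩
  refine (salvettiAug_apply Γ _).trans ?_
  simp [extend]

lemma exists_salvettiD_zero_eq (x : CliqueIndex Γ 0 →₀ MonoidAlgebra ℤ (RAAG Γ))
    (hx : (salvettiAug Γ).hom x = 0) : ∃ y, salvettiD Γ 0 y = x := by
  refine exists_salvettiD_eq Γ 0 x ?_ fun _ => ?_
  · exact Koszul.diff_eq_zero_of_mem_chains_zero _ ((chainsEquiv Γ 0).symm x).2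
  · rw [Finset.coe_univ, Set.image_univ]
    refine mem_span_of_extend_eq_zero ?_
    have h := (salvettiAug_apply Γ x).symm.trans hx
    rw [← (chainsEquiv Γ 0).apply_symm_apply x] at h
    exact h

/-- The Salvetti complex: the chain complex of the universal cover of the Salvetti complex of the
right-angled Artin group. -/
noncomputable def salvettiComplex : ChainComplex (Rep ℤ (RAAG Γ)) ℕ :=
  ChainComplex.of (fun n => Rep.free ℤ (RAAG Γ) (CliqueIndex Γ n))
    (fun n => Rep.freeMap (salvettiD Γ n))
    (fun n => Rep.hom_ext <| Representation.IntertwiningMap.ext <|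
      LinearMap.ext <| salvettiD_comp Γ n)

lemma salvettiComplex_d (n : ℕ) :
    (salvettiComplex Γ).d (n + 1) n = Rep.freeMap (salvettiD Γ n) :=
  by simp [salvettiComplex]

lemma salvettiComplex_d_comp_aug : (salvettiComplex Γ).d 1 0 ≫ salvettiAug Γ = 0 := by
  rw [salvettiComplex_d]
  exact Rep.hom_ext <| Representation.IntertwiningMap.ext <| LinearMap.ext
    fun x => extend_salvettiD Γ 0 x (emptyClique Γ)

/-- The augmentation as a map of complexes. -/
noncomputable def salvettiπ :
    salvettiComplex Γ ⟶ (ChainComplex.single₀ _).obj (Rep.trivial ℤ (RAAG Γ) ℤ) :=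
  ((salvettiComplex Γ).toSingle₀Equiv _).symm ⟨salvettiAug Γ, salvettiComplex_d_comp_aug Γ⟩

lemma salvettiπ_f_zero : (salvettiπ Γ).f 0 = salvettiAug Γ :=
  ChainComplex.toSingle₀Equiv_symm_apply_f_zero _ _

lemma salvettiπ_quasiIso : QuasiIso (salvettiπ Γ) where
  quasiIsoAt m := by
    cases m with
    | zero =>
      rw [ChainComplex.quasiIsoAt₀_iff, ShortComplex.quasiIso_iff_of_zeros' _ rfl rfl rfl]
      constructor
      · refine Rep.shortComplex_exact_of_forall _ fun x hx => ?_
        change ((salvettiπ Γ).f 0).hom x = 0 at hx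
        change ∃ y, ((salvettiComplex Γ).d 1 0).hom y = x
        rw [salvettiπ_f_zero] at hx
        rw [salvettiComplex_d]
        exact exists_salvettiD_zero_eq Γ x hx
      · rw [Rep.epi_iff_surjective]
        intro x
        change ∃ y, ((salvettiπ Γ).f 0).hom y = x
        rw [salvettiπ_f_zero]
        exact salvettiAug_surjective Γ x
    | succ m =>
      rw [quasiIsoAt_iff_exactAt' (hL := ChainComplex.exactAt_succ_single_obj ..),
          HomologicalComplex.exactAt_iff' _ (m + 2) (m + 1) m (by simp) (by simp)]
      refine Rep.shortComplex_exact_of_forall _ fun x hx => ?_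
      change ((salvettiComplex Γ).d (m + 1) m).hom x = 0 at hx
      change ∃ y, ((salvettiComplex Γ).d (m + 2) (m + 1)).hom y = x
      rw [salvettiComplex_d] at hx
      rw [salvettiComplex_d]
      exact (range_salvettiD_succ Γ m).ge hx

/-- The Salvetti complex is a free resolution of the trivial representation. -/
noncomputable def salvettiResolution : ProjectiveResolution (Rep.trivial ℤ (RAAG Γ) ℤ) where
  complex := salvettiComplex Γ
  projective n := inferInstanceAs (Projective (Rep.free ℤ (RAAG Γ) (CliqueIndex Γ n)))
  π := salvettiπ Γ
  quasiIso := salvettiπ_quasiIso Γ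

/-- The integral homology of a right-angled Artin group in degree `n` is free on the cliques with
`n` vertices. -/
theorem nonempty_homologyEquiv (n : ℕ) :
    Nonempty (integralGroupHomology (RAAG Γ) n ≃ₗ[ℤ] (CliqueIndex Γ n →₀ ℤ)) := by
  classical
  let C := (salvettiResolution Γ).complex.coinvariantsTensorObj (Rep.trivial ℤ (RAAG Γ) ℤ)
  have hd : ∀ i j, C.d i j = 0 := by
    intro i j
    by_cases hij : j + 1 = i
    · subst hij
      change ((Rep.coinvariantsTensor ℤ _).obj _).map ((salvettiComplex Γ).d (j + 1) j) = 0
      rw [salvettiComplex_d]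
      exact Rep.coinvariantsTensor_map_freeMap_eq_zero _ (extend_salvettiD Γ j)
    · exact C.shape _ _ hij
  let e1 := groupHomologyIso (Rep.trivial ℤ (RAAG Γ) ℤ) n (salvettiResolution Γ)
  let e2 : C.homology n ≅ C.X n :=
    (ShortComplex.HomologyData.ofZeros (C.sc n) (hd _ _) (hd _ _)).left.homologyIso
  exact ⟨(e1 ≪≫ e2).toLinearEquiv ≪≫ₗ
    Rep.coinvariantsTensorFreeLEquiv (Rep.trivial ℤ (RAAG Γ) ℤ) (CliqueIndex Γ n)⟩

theorem finite_integralGroupHomology (n : ℕ) :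
    Module.Finite ℤ (integralGroupHomology (RAAG Γ) n) :=
  Module.Finite.equiv (nonempty_homologyEquiv Γ n).some.symm

theorem groupBettiNumber_eq (n : ℕ) :
    groupBettiNumber (RAAG Γ) n = Nat.card (CliqueIndex Γ n) := by
  classical
  have := Fintype.ofFinite (CliqueIndex Γ n)
  rw [groupBettiNumber, (nonempty_homologyEquiv Γ n).some.finrank_eq,
    Module.finrank_finsupp_self, Nat.card_eq_fintype_card]

end RAAG

end Homology

/-! ### Expected number of cliques in a random graph -/

namespace SimpleGraph

open MeasureTheory Measure ProbabilityTheory unitInterval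

variable {V : Type*} [DecidableEq V]

lemma isClique_iff_image_offDiag_subset (Γ : SimpleGraph V) (s : Finset V) :
    Γ.IsClique (s : Set V) ↔ ∀ e ∈ s.offDiag.image Sym2.mk.uncurry, e ∈ Γ.edgeSet := by
  constructor
  · intro h e he
    obtain ⟨⟨x, y⟩, hxy, rfl⟩ := Finset.mem_image.1 he
    obtain ⟨hx, hy, hne⟩ := Finset.mem_offDiag.1 hxy
    exact h hx hy hne
  · intro h x hx y hy hxy
    exact h s(x, y) (Finset.mem_image.2 ⟨(x, y), Finset.mem_offDiag.2 ⟨hx, hy, hxy⟩, rfl⟩)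

variable [Fintype V]

lemma binomialRandom_isClique (p : I) (s : Finset V) :
    (binomialRandom V p).real {Γ | Γ.IsClique (s : Set V)} = (p : ℝ) ^ s.card.choose 2 := by
  set E := s.offDiag.image Sym2.mk.uncurry with hE
  have hdiag : ∀ e ∈ E, ¬ e.IsDiag := by
    intro e he
    obtain ⟨⟨x, y⟩, hxy, rfl⟩ := Finset.mem_image.1 he
    exact (Finset.mem_offDiag.1 hxy).2.2
  -- As a set of edge indicators, the event is a box: `True` on pairs inside `s`, `False` on loops,
  -- unconstrained elsewhere. Its product measure is therefore a product of factors.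
  have himage : ((fun (G : SimpleGraph V) e ↦ e ∈ G.edgeSet) '' {Γ | Γ.IsClique (s : Set V)}) =
      Set.pi Set.univ fun e : Sym2 V => if e ∈ E then {True} else
        if e.IsDiag then {False} else Set.univ := by
    ext f
    constructor
    · rintro ⟨G, hG, rfl⟩ e -
      have h := (isClique_iff_image_offDiag_subset G s).1 hG e
      beta_reduce
      split_ifs with h1 h2
      · simpa using h h1
      · simpa using fun h3 => G.not_isDiag_of_mem_edgeSet h3 h2
      · trivial
    · intro hf
      have hfE : ∀ e ∈ E, f e := fun e he => by
        have := hf e trivial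
        beta_reduce at this
        rw [if_pos he] at this
        exact of_eq_true this
      have hfd : ∀ e : Sym2 V, e.IsDiag → ¬ f e := fun e he => by
        have := hf e trivial
        beta_reduce at this
        rw [if_neg (fun h => hdiag e h he), if_pos he] at this
        exact of_eq_false this
      refine ⟨fromEdgeSet {e | f e}, (isClique_iff_image_offDiag_subset _ s).2 fun e he => ?_, ?_⟩
      · rw [edgeSet_fromEdgeSet]
        exact ⟨hfE e he, hdiag e he⟩
      · funext e
        beta_reduce
        rw [edgeSet_fromEdgeSet]
        exact propext ⟨fun h => h.1, fun h => ⟨h, fun h' => hfd e h' h⟩⟩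
  have hfactor : ∀ e : Sym2 V,
      (toNNReal p • dirac (¬ e.IsDiag) + toNNReal (σ p) • dirac False : Measure Prop)
        (if e ∈ E then {True} else if e.IsDiag then {False} else Set.univ) =
      if e ∈ E then (toNNReal p : ENNReal) else 1 := by
    intro e
    split_ifs with h1 h2
    · simp [hdiag e h1]
    · have : toNNReal p + toNNReal (σ p) = 1 := by ext; simp
      simp [h2, ← ENNReal.coe_add, this]
    · exact measure_univ
  rw [measureReal_def, binomialRandom_apply, himage, infinitePi_eq_pi, pi_pi,
    Finset.prod_congr rfl fun e _ => hfactor e, Finset.prod_ite_mem, Finset.univ_inter,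
    Finset.prod_const, hE, Sym2.card_image_offDiag]
  simp

lemma integral_card_cliques (p : I) (r : ℕ) :
    ∫ Γ : SimpleGraph V, (Nat.card {s : Finset V // Γ.IsNClique r s} : ℝ)
        ∂(binomialRandom V p) =
      ((Fintype.card V).choose r : ℝ) * (p : ℝ) ^ r.choose 2 := by
  classical
  have h : ∀ Γ : SimpleGraph V, (Nat.card {s : Finset V // Γ.IsNClique r s} : ℝ) =
      ∑ s ∈ (Finset.univ : Finset V).powersetCard r,
        Set.indicator {Γ : SimpleGraph V | Γ.IsClique (s : Set V)} (fun _ => (1 : ℝ)) Γ := by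
    intro Γ
    rw [Nat.card_eq_fintype_card, Fintype.card_subtype]
    simp only [Set.indicator_apply, Set.mem_ofPred_eq]
    rw [Finset.sum_boole]
    congr 2
    ext s
    simp [isNClique_iff, and_comm]
  simp_rw [h]
  -- There are finitely many edge indicators, so every set of graphs is the preimage of a finite,
  -- hence measurable, set.
  have hmeas : ∀ S : Set (SimpleGraph V), MeasurableSet S := fun S => by
    rw [← edgeSet_injective.preimage_image S]
    exact measurable_edgeSet (Set.toFinite _).measurableSet
  rw [integral_finsetSum _ fun s _ =>
    (integrable_const (1 : ℝ)).indicator (hmeas _)]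
  rw [Finset.sum_congr rfl fun s hs => ?_, Finset.sum_const, Finset.card_powersetCard,
    Finset.card_univ, nsmul_eq_mul]
  rw [integral_indicator_const _ (hmeas _), binomialRandom_isClique,
    (Finset.mem_powersetCard.1 hs).2, smul_eq_mul, mul_one]

end SimpleGraph

/-! ### The expected Betti number -/

theorem lemma2p1 (n r : ℕ) (hr : 2 ≤ r) (p : ℝ) (hp0 : 0 < p) (hp1 : p < 1) :
    (∀ Γ : SimpleGraph (Fin n), Module.Finite ℤ (integralGroupHomology (RAAG Γ) r)) ∧
    ∫ Γ : SimpleGraph (Fin n), (groupBettiNumber (RAAG Γ) r : ℝ)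
        ∂(SimpleGraph.binomialRandom (Fin n) ⟨p, hp0.le, hp1.le⟩) =
      (n.choose r : ℝ) * p ^ (r.choose 2) := by
  refine ⟨fun Γ => RAAG.finite_integralGroupHomology Γ r, ?_⟩
  have h : ∀ Γ : SimpleGraph (Fin n),
      groupBettiNumber (RAAG Γ) r = Nat.card {s : Finset (Fin n) // Γ.IsNClique r s} := by
    intro Γ
    rw [RAAG.groupBettiNumber_eq]
    refine Nat.card_congr (Equiv.subtypeEquivRight fun s => ?_)
    simp [Koszul.mem_cliques]
  simp_rw [h]
  rw [SimpleGraph.integral_card_cliques, Fintype.card_fin]
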